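/- Fix positive integers $F, K, D$ and erasure probabilities $1\ge\delta_1\ge\dots\ge\delta_K\ge 0$. A transmitter has $D$ independent messages; at blocklength $n$ the message $W_d$ is uniform on a set of $\lceil 2^{nR_d}\rceil$ elements, $R_d\ge 0$. Before the demand is known, receiver $k\in\{1,\dots,K\}$ stores $Z_k=g_k(W_1,\dots,W_D)\in\mathcal Z_k$, where $|\mathcal Z_k|\le 2^{nM_k}$ and $M_k\ge 0$ is real. Then all receivers demand one common message $W_d$, the transmitter sends $X^n=f_d(W_1,\dots,W_D)$ with letters in $\{0,1\}^F$ over a memoryless broadcast channel, and receiver $k$ forms an estimate $\hat W_{k,d}$ of $W_d$ from $Z_k$, its channel outputs and $d$. The channel has any joint law under which receiver $k$ observes the sent packet with probability $1-\delta_k$ and an erasure symbol with probability $\delta_k$. The error probability is $\mathsf P_e=\Pr\big[\bigcup_{d}\bigcup_{k}\{\hat W_{k,d}\ne W_d\}\big]$, where the delivery phases for different $d$ use the channel independently given the messages. A tuple $(R_1,\dots,R_D,M_1,\dots,M_K)$ of nonnegative reals is achievable if for every $\epsilon>0$ there are codes of arbitrarily large blocklength $n$ with $\mathsf P_e\le\epsilon$.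 The capacity-memory region is the closure of the set of achievable tuples. **Theorem.** A tuple $(R_1,\dots,R_D,M_1,\dots,M_K)$ of nonnegative reals lies in the capacity-memory region if and only if there are nonnegative numbers $M_{k,d}$ with $\sum_{d=1}^D M_{k,d}\le M_k$ for every $k$ and $$R_d\le\min_{k\in\{1,\dots,K\}}\big((1-\delta_k)F+M_{k,d}\big)\qquad\text{for every } d\in\{1,\dots,D\}.$$ In particular, this condition is necessary for achievability. Conversely, if there are nonnegative $M_{k,d}$ with $\sum_{d} M_{k,d}\le M_k$ for every $k$ such that $R_d<\min_k\big((1-\delta_k)F+M_{k,d}\big)$ for every $d$ with $R_d>0$, then the tuple itself is achievable. -/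

import Mathlib

noncomputable section

namespace ErasureCaching

/-- The channel input alphabet `{0,1}^F`: packets of `F` bits. -/
abbrev Packet (F : ℕ) : Type := Fin F → Bool

/-- The output alphabet of every receiver: a packet, or the erasure symbol `none`. -/
abbrev Output (F : ℕ) : Type := Option (Packet F)

/-- One use of an erasure broadcast channel with `K` receivers: an arbitrary joint transition law
`law x (y₁, …, y_K)` whose `k`-th marginal is the erasure channel with erasure probability `δ k`. -/
structure ErasureBC (F K : ℕ) (δ : Fin K → ℝ) where
  law : Packet F → (Fin K → Output F) → ℝ
  law_nonneg : ∀ x y, 0 ≤ law x y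
  law_sum : ∀ x, ∑ y, law x y = 1
  law_marginal : ∀ (x : Packet F) (k : Fin K) (z : Output F),
    ∑ y with y k = z, law x y =
      if z = some x then 1 - δ k else if z = none then δ k else 0

/-- The memoryless extension to `n` channel uses: the probability that the receivers observe
`y` (`y t k` is the output at receiver `k` at time `t`) when `x` is sent. -/
def ErasureBC.lawN {F K : ℕ} {δ : Fin K → ℝ} (Q : ErasureBC F K δ) {n : ℕ}
    (x : Fin n → Packet F) (y : Fin n → Fin K → Output F) : ℝ :=
  ∏ t, Q.law (x t) (y t)

/-- The number of values of a message of rate `r` at blocklength `n`: `2 ^ (n r)`, rounded up when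
it is not an integer. -/
def numMessages (n : ℕ) (r : ℝ) : ℕ := ⌈(2 : ℝ) ^ ((n : ℝ) * r)⌉₊

/-- The realizations `(w_1, …, w_D)` of the message library. -/
abbrev Library {D : ℕ} (n : ℕ) (R : Fin D → ℝ) : Type :=
  ∀ d : Fin D, Fin (numMessages n (R d))

/-- An `(n, R_1, …, R_D, M_1, …, M_K)`-code for the set `𝒟` of feasible demands: the cache of
receiver `k` takes `cacheSize k ≤ 2 ^ (n M_k)` values; the caching functions do not see the
demand, the encoder and the decoders do. -/
structure Code (F : ℕ) {K D : ℕ} (𝒟 : Finset (Fin K → Fin D)) (n : ℕ)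
    (R : Fin D → ℝ) (M : Fin K → ℝ) where
  cacheSize : Fin K → ℕ
  cacheSize_le : ∀ k, (cacheSize k : ℝ) ≤ (2 : ℝ) ^ ((n : ℝ) * M k)
  cache : ∀ k, Library n R → Fin (cacheSize k)
  encode : 𝒟 → Library n R → Fin n → Packet F
  decode : ∀ (k : Fin K) (d : 𝒟), (Fin n → Output F) → Fin (cacheSize k) →
    Fin (numMessages n (R (d.1 k)))

section Error

variable {F K D n : ℕ} {𝒟 : Finset (Fin K → Fin D)} {R : Fin D → ℝ} {M : Fin K → ℝ}

/-- Some receiver errs for some feasible demand, when the library is `w` and, for each feasible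
demand `d`, the receivers observe `y d` in the delivery phase for `d`. -/
def Code.Error (C : Code F 𝒟 n R M) (w : Library n R)
    (y : 𝒟 → Fin n → Fin K → Output F) : Prop :=
  ∃ (d : 𝒟) (k : Fin K), C.decode k d (fun t => y d t k) (C.cache k w) ≠ w (d.1 k)

open Classical in
/-- The probability of error at any receiver for any feasible demand. The library is uniform (so
the messages are independent and uniform); given the library, the delivery phase of each feasible
demand `d` uses the memoryless channel with input `encode d w`, independently over `d`. -/
def Code.errorProb (C : Code F 𝒟 n R M) {δ : Fin K → ℝ} (Q : ErasureBC F K δ) : ℝ :=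
  ∑ w : Library n R, (1 / (Fintype.card (Library n R) : ℝ)) *
    ∑ y : 𝒟 → Fin n → Fin K → Output F,
      (∏ d : 𝒟, Q.lawN (C.encode d w) (y d)) * (if C.Error w y then 1 else 0)

end Error

/-- Achievable rate-memory tuples: for every `ε > 0` there are codes of arbitrarily large
blocklength whose error probability is at most `ε`. -/
def IsAchievable {F K D : ℕ} {δ : Fin K → ℝ} (Q : ErasureBC F K δ)
    (𝒟 : Finset (Fin K → Fin D)) (R : Fin D → ℝ) (M : Fin K → ℝ) : Prop :=
  (∀ d, 0 ≤ R d) ∧ (∀ k, 0 ≤ M k) ∧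
    ∀ ε : ℝ, 0 < ε → ∀ n₀ : ℕ, ∃ n ≥ n₀, ∃ C : Code F 𝒟 n R M, C.errorProb Q ≤ ε

/-- The capacity-memory region: the closure of the set of achievable rate-memory tuples. -/
def capacityMemoryRegion {F K D : ℕ} {δ : Fin K → ℝ} (Q : ErasureBC F K δ)
    (𝒟 : Finset (Fin K → Fin D)) : Set ((Fin D → ℝ) × (Fin K → ℝ)) :=
  closure {p | IsAchievable Q 𝒟 p.1 p.2}

/-- The feasible set of a single common demand: all receivers demand the same message. -/
def commonDemands (K D : ℕ) : Finset (Fin K → Fin D) := {d | ∀ j k, d j = d k}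

/-- `S k d` is a split of the cache memories `M k` among the messages. -/
def IsCacheSplit {K D : ℕ} (M : Fin K → ℝ) (S : Fin K → Fin D → ℝ) : Prop :=
  (∀ k d, 0 ≤ S k d) ∧ ∀ k, ∑ d, S k d ≤ M k

end ErasureCaching

end

noncomputable section

namespace ErasureCaching

open Finset

/-! Converse: fix a receiver `k` and a set `A` of messages. Its cache and the unerased packets of
the deliveries for `A` must determine all messages in `A`. Hence, for a fixed erasure pattern, the
libraries decoded correctly number at most (values of the other messages) × (cache values) × `2 ^ (F
* unerased slots)` (`Code.card_correct_le`). Averaging over erasures with a Chernoff bound, the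
success probability decays exponentially once `∑ d ∈ A, (R d - (1 - δ k) * F)` exceeds `M k`
(`sum_rate_le_of_isAchievable`). The best `A` keeps the nonnegative summands; the resulting
condition is equivalent to the existence of a split (`exists_split_iff`) and is closed, so it passes
to the closure.

Achievability: the messages are coded separately. Each value of `W_d` gets a random codeword and,
for every receiver, a random cache index with about `2 ^ (n * S k d)` values. Another value agrees
with both the index and the unerased packets with probability inverse to (index values) × `2 ^ (F *
unerased slots)`, so a union bound (`exists_label`) and the same Chernoff bound
(`tendsto_sum_min_collision`) suffice. Boundary points are limits of tuples with lowered rates. -/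

/-- The probability of the erasure pattern `e`, where `e i` says that slot `i` is not erased. -/
def patternWeight {ι : Type*} [Fintype ι] (δ : ℝ) (e : ι → Bool) : ℝ :=
  ∏ i, if e i then 1 - δ else δ

/-- The output of an erasure channel with input `x` and erasure pattern `e`. -/
def observe {ι α : Type*} (x : ι → α) (e : ι → Bool) : ι → Option α :=
  fun i => if e i then some (x i) else none

/-! ### Sums over product distributions. -/

section Sums

/-- The image of a product law under a coordinatewise map is the product of the image laws; group
`y` by fibres. -/
lemma sum_prod_mul_comp {ι Y Z : Type*} [Fintype ι] [DecidableEq ι] [Fintype Y] [Fintype Z]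
    [DecidableEq Z] (p : ι → Y → ℝ) (g : ι → Y → Z) (f : (ι → Z) → ℝ) :
    ∑ y : ι → Y, (∏ i, p i (y i)) * f (fun i => g i (y i)) =
      ∑ z : ι → Z, (∏ i, ∑ y with g i y = z i, p i y) * f z := by
  rw [← Finset.sum_fiberwise (s := univ) (g := fun (y : ι → Y) i => g i (y i))]
  refine Finset.sum_congr rfl fun z _ => ?_
  rw [Finset.prod_univ_sum, Finset.sum_mul]
  refine Finset.sum_congr ?_ ?_
  · ext y
    simp [funext_iff]
  · intro y hy
    have : (fun i => g i (y i)) = z := by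
      funext i
      simpa using (Fintype.mem_piFinset.1 hy i)
    rw [this]

/-- Integrates out every coordinate except `j`: `f` is absorbed into the `j`-th factor and the
others sum to 1. -/
lemma sum_prod_mul_apply {ι : Type*} [Fintype ι] [DecidableEq ι] {β : ι → Type*}
    [∀ i, Fintype (β i)] (p : ∀ i, β i → ℝ) (hp : ∀ i, ∑ b, p i b = 1) (j : ι) (f : β j → ℝ) :
    ∑ y : ∀ i, β i, (∏ i, p i (y i)) * f (y j) = ∑ b, p j b * f b := by
  classical
  let G : ∀ i, β i → ℝ := Function.update (fun _ _ => 1) j f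
  have h1 : ∀ y : ∀ i, β i, (∏ i, p i (y i)) * f (y j) = ∏ i, p i (y i) * G i (y i) := by
    intro y
    rw [Finset.prod_mul_distrib]
    congr 1
    rw [Finset.prod_eq_single j (fun i _ hi => by simp [G, hi]) (by simp)]
    simp [G]
  simp_rw [h1]
  rw [← Fintype.prod_sum (fun i b => p i b * G i b),
    Finset.prod_eq_single j (fun i _ hi => by simp [G, hi, hp]) (by simp)]
  simp [G]

lemma patternWeight_nonneg {ι : Type*} [Fintype ι] {δ : ℝ} (h0 : 0 ≤ δ) (h1 : δ ≤ 1)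
    (e : ι → Bool) : 0 ≤ patternWeight δ e :=
  Finset.prod_nonneg fun i _ => by split_ifs <;> linarith

lemma sum_patternWeight_mul_prod {ι : Type*} [Fintype ι] [DecidableEq ι] (δ : ℝ) (a : ι → ℝ) :
    ∑ e : ι → Bool, patternWeight δ e * ∏ i, (if e i then a i else 1) =
      ∏ i, ((1 - δ) * a i + δ) := by
  simp_rw [patternWeight, ← Finset.prod_mul_distrib]
  rw [← Fintype.prod_sum
    (fun i (b : Bool) => (if b = true then 1 - δ else δ) * (if b = true then a i else 1))]
  simp

end Sums

/-! ### The Chernoff bound shared by both directions. -/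

section Tail

/-- The cap at 1 handles `a ≥ 0`, the other term handles `a ≤ 0`; this is where `l ≤ 1` is needed.
-/
lemma min_one_mul_exp_le {C a l : ℝ} (hC : 1 ≤ C) (hl0 : 0 ≤ l) (hl1 : l ≤ 1) :
    min 1 (C * Real.exp a) ≤ C * Real.exp (l * a) := by
  rcases le_total 0 a with ha | ha
  · have : 1 ≤ Real.exp (l * a) := Real.one_le_exp (by positivity)
    exact (min_le_left _ _).trans (by nlinarith)
  · refine (min_le_right _ _).trans ?_
    gcongr
    nlinarith

lemma sum_patternWeight_min_le {ι : Type*} [Fintype ι] [DecidableEq ι] {δ C l : ℝ}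
    (h0 : 0 ≤ δ) (h1 : δ ≤ 1) (hC : 1 ≤ C) (hl0 : 0 ≤ l) (hl1 : l ≤ 1) (v : ℝ) (s : ι → ℝ) :
    ∑ e : ι → Bool, patternWeight δ e *
        min 1 (C * Real.exp (v + ∑ i, if e i then s i else 0)) ≤
      C * Real.exp (l * v) * ∏ i, ((1 - δ) * Real.exp (l * s i) + δ) := by
  rw [← sum_patternWeight_mul_prod, Finset.mul_sum]
  refine Finset.sum_le_sum fun e _ => ?_
  have h : Real.exp (l * (v + ∑ i, if e i then s i else 0)) =
      Real.exp (l * v) * ∏ i, (if e i then Real.exp (l * s i) else 1) := by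
    rw [mul_add, Real.exp_add, Finset.mul_sum, Real.exp_sum]
    congr 1
    refine Finset.prod_congr rfl fun i _ => ?_
    split_ifs <;> simp
  calc _ ≤ patternWeight δ e * (C * Real.exp (l * (v + ∑ i, if e i then s i else 0))) :=
        mul_le_mul_of_nonneg_left (min_one_mul_exp_le hC hl0 hl1) (patternWeight_nonneg h0 h1 e)
    _ = _ := by rw [h]; ring

/-- The function of `l` equals 1 at 0 and has derivative `u + (1 - δ) * s < 0` there, so it drops
below 1 for small positive `l`. -/
lemma exists_exp_mul_lt_one {δ u s : ℝ} (h : u + (1 - δ) * s < 0) :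
    ∃ l : ℝ, 0 ≤ l ∧ l ≤ 1 ∧ Real.exp (l * u) * ((1 - δ) * Real.exp (l * s) + δ) < 1 := by
  have hd : HasDerivAt (fun l : ℝ => Real.exp (l * u) * ((1 - δ) * Real.exp (l * s) + δ))
      (u + (1 - δ) * s) 0 := by
    have e1 : HasDerivAt (fun l : ℝ => Real.exp (l * u)) u 0 := by
      simpa using ((hasDerivAt_id (0 : ℝ)).mul_const u).exp
    have e2 : HasDerivAt (fun l : ℝ => Real.exp (l * s)) s 0 := by
      simpa using ((hasDerivAt_id (0 : ℝ)).mul_const s).exp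
    have e3 := e1.mul ((e2.const_mul (1 - δ)).add_const δ)
    simp only [zero_mul, Real.exp_zero, mul_one, one_mul, sub_add_cancel] at e3
    exact e3
  have h2 := hasDerivWithinAt_iff_tendsto_slope.1 (hd.hasDerivWithinAt (s := Set.Ioi 0))
  have h3 := (tendsto_order.1 h2).2 0 h
  rw [Set.sdiff_singleton_eq_self (by simp)] at h3
  have h4 : ∀ᶠ x : ℝ in nhdsWithin 0 (Set.Ioi 0), x ∈ Set.Ioc (0 : ℝ) 1 :=
    Ioc_mem_nhdsGT one_pos
  obtain ⟨l, hl, hl'⟩ := (h3.and h4).exists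
  refine ⟨l, hl'.1.le, hl'.2, ?_⟩
  rw [slope_def_field] at hl
  have := (div_neg_iff.1 hl).resolve_left (fun h => by linarith [hl'.1, h.2])
  have h5 := this.1
  simp only [zero_mul, Real.exp_zero] at h5
  linarith

end Tail

/-! ### Reduction of the broadcast channel to the erasure pattern of one receiver. -/

section Marginal

variable {F K n : ℕ} {δ : Fin K → ℝ}

/-- An event seen by one receiver depends only on its marginal, so the joint law of the channel
plays no role. -/
lemma sum_law_mul_comp (Q : ErasureBC F K δ) {ι : Type*} [Fintype ι] [DecidableEq ι]
    (x : ι → Packet F) (k : Fin K) (f : (ι → Output F) → ℝ) :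
    ∑ y : ι → Fin K → Output F, (∏ i, Q.law (x i) (y i)) * f (fun i => y i k) =
      ∑ e : ι → Bool, patternWeight (δ k) e * f (observe x e) := by
  rw [sum_prod_mul_comp (fun i => Q.law (x i)) (fun _ y => y k) f]
  have := sum_prod_mul_comp (fun (_ : ι) (b : Bool) => if b then 1 - δ k else δ k)
    (fun i b => if b then some (x i) else none) f
  unfold patternWeight observe
  rw [this]
  refine Finset.sum_congr rfl fun z _ => ?_
  congr 1
  refine Finset.prod_congr rfl fun i _ => ?_
  rw [Q.law_marginal, Finset.sum_filter]
  rcases z i with _ | p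
  · simp
  · simp [eq_comm]

lemma sum_lawN (Q : ErasureBC F K δ) (x : Fin n → Packet F) : ∑ y, Q.lawN x y = 1 := by
  unfold ErasureBC.lawN
  rw [← Fintype.prod_sum (fun t (y : Fin K → Output F) => Q.law (x t) y)]
  simp [Q.law_sum]

lemma lawN_nonneg (Q : ErasureBC F K δ) (x : Fin n → Packet F) (y) : 0 ≤ Q.lawN x y :=
  Finset.prod_nonneg fun _ _ => Q.law_nonneg _ _

/-- All delivery phases together form one memoryless channel whose slots are pairs (phase, time). -/
lemma sum_prod_lawN_mul_comp (Q : ErasureBC F K δ) {ι : Type*} [Fintype ι] [DecidableEq ι]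
    (x : ι → Fin n → Packet F) (k : Fin K) (f : (ι → Fin n → Output F) → ℝ) :
    ∑ y : ι → Fin n → Fin K → Output F,
        (∏ i, Q.lawN (x i) (y i)) * f (fun i t => y i t k) =
      ∑ e : ι × Fin n → Bool, patternWeight (δ k) e *
        f (fun i => observe (x i) (fun t => e (i, t))) := by
  have h := sum_law_mul_comp Q (fun i : ι × Fin n => x i.1 i.2) k
    (fun z => f (fun i t => z (i, t)))
  unfold observe at h ⊢
  rw [← h]
  refine (Fintype.sum_equiv (Equiv.curry ι (Fin n) (Fin K → Output F)) _ _ fun y => ?_).symm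
  simp only [Equiv.curry_apply, Function.curry, ErasureBC.lawN, Fintype.prod_prod_type]

end Marginal

/-! ### Converse: counting correctly decoded libraries. -/

section Converse

variable {F K D n : ℕ} {𝒟 : Finset (Fin K → Fin D)} {R : Fin D → ℝ} {M : Fin K → ℝ}
  {δ : Fin K → ℝ}

lemma rpow_le_numMessages (n : ℕ) (r : ℝ) :
    (2 : ℝ) ^ ((n : ℝ) * r) ≤ numMessages n r := Nat.le_ceil _

lemma numMessages_pos (n : ℕ) (r : ℝ) : 0 < numMessages n r :=
  Nat.ceil_pos.2 (by positivity)

/-- Receiver `k` decodes correctly for the demands in `B`, when the library is `w` and its erasure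
patterns are given by `e`. -/
def Code.Correct (C : Code F 𝒟 n R M) (k : Fin K) (B : Finset 𝒟) (e : 𝒟 × Fin n → Bool)
    (w : Library n R) : Prop :=
  ∀ c ∈ B, C.decode k c (observe (C.encode c w) (fun t => e (c, t))) (C.cache k w) = w (c.1 k)

open Classical in
-- On correctly decoded libraries, the messages outside `A`, the cache content and the unerased
-- packets determine `w`, since the messages in `A` are decoder outputs. Count the values of this
-- triple.
lemma Code.card_correct_le (C : Code F 𝒟 n R M) (k : Fin K) (A : Finset (Fin D)) (B : Finset 𝒟)
    (hAB : ∀ d ∈ A, ∃ c ∈ B, c.1 k = d) (e : 𝒟 × Fin n → Bool) :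
    #{w | C.Correct k B e w} ≤ (∏ d ∈ Aᶜ, numMessages n (R d)) *
      (C.cacheSize k * (2 ^ F) ^ #{i : 𝒟 × Fin n | i.1 ∈ B ∧ e i}) := by
  let T := (∀ d : {d // d ∈ Aᶜ}, Fin (numMessages n (R d))) × Fin (C.cacheSize k) ×
    ({i : 𝒟 × Fin n // i ∈ ({i : 𝒟 × Fin n | i.1 ∈ B ∧ e i} : Finset _)} → Packet F)
  let φ : Library n R → T := fun w => (fun d => w d, C.cache k w, fun i => C.encode i.1.1 w i.1.2)
  have hinj : Set.InjOn φ (({w | C.Correct k B e w} : Finset _) : Set (Library n R)) := by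
    intro w hw w' hw' h
    rw [Finset.mem_coe, Finset.mem_filter] at hw hw'
    replace hw := hw.2
    replace hw' := hw'.2
    have h1 := congrArg Prod.fst h
    have h2 : C.cache k w = C.cache k w' := congrArg (fun p => p.2.1) h
    have h3 := congrArg (fun p => p.2.2) h
    funext d
    by_cases hd : d ∈ A
    · obtain ⟨c, hc, rfl⟩ := hAB d hd
      rw [← hw c hc, ← hw' c hc, h2]
      congr 1
      funext t
      unfold observe
      by_cases ht : e (c, t) = true
      · simp only [ht, if_true]
        exact congrArg some (congrFun h3 ⟨(c, t), by simp [hc, ht]⟩)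
      · simp [ht]
    · exact congrFun h1 ⟨d, by simpa using hd⟩
  have := Finset.card_le_card_of_injOn (t := univ) φ (fun _ _ => by simp) hinj
  refine this.trans_eq ?_
  rw [Finset.card_univ, Fintype.card_prod, Fintype.card_prod, Fintype.card_pi, Fintype.card_fun]
  simp only [Fintype.card_fin, Fintype.card_coe, Fintype.card_bool, Fintype.card_fun]
  rw [Finset.prod_coe_sort Aᶜ (fun d => numMessages n (R d))]

open Classical in
lemma Code.card_correct_div_le (C : Code F 𝒟 n R M) (k : Fin K) (A : Finset (Fin D))
    (B : Finset 𝒟) (hAB : ∀ d ∈ A, ∃ c ∈ B, c.1 k = d) (e : 𝒟 × Fin n → Bool) :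
    (#{w | C.Correct k B e w} : ℝ) / Fintype.card (Library n R) ≤
      min 1 (1 * Real.exp (n * (M k - ∑ d ∈ A, R d) * Real.log 2 +
        ∑ i, if e i then (if i.1 ∈ B then F * Real.log 2 else 0) else 0)) := by
  have hL : (0 : ℝ) < Fintype.card (Library n R) := by
    have : Nonempty (Library n R) := ⟨fun d => ⟨0, numMessages_pos _ _⟩⟩
    exact_mod_cast Fintype.card_pos
  refine le_min ?_ ?_
  · rw [div_le_one hL]
    exact_mod_cast Finset.card_le_univ _
  have hcard : (Fintype.card (Library n R) : ℝ) =
      (∏ d ∈ A, (numMessages n (R d) : ℝ)) * ∏ d ∈ Aᶜ, (numMessages n (R d) : ℝ) := by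
    rw [Finset.prod_mul_prod_compl, Fintype.card_pi]
    simp
  have hexp : (∑ i, if e i then (if i.1 ∈ B then F * Real.log 2 else 0) else 0) =
      Real.log 2 * (F * #{i : 𝒟 × Fin n | i.1 ∈ B ∧ e i}) := by
    rw [Finset.card_filter]
    push_cast
    rw [Finset.mul_sum, Finset.mul_sum]
    refine Finset.sum_congr rfl fun i _ => ?_
    by_cases h1 : e i = true <;> by_cases h2 : i.1 ∈ B <;> simp [h1, h2, mul_comm]
  have h1 : (#{w | C.Correct k B e w} : ℝ) ≤ (∏ d ∈ Aᶜ, (numMessages n (R d) : ℝ)) *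
      (C.cacheSize k * (2 ^ F) ^ #{i : 𝒟 × Fin n | i.1 ∈ B ∧ e i}) := by
    exact_mod_cast C.card_correct_le k A B hAB e
  have hA : (2 : ℝ) ^ (∑ d ∈ A, n * R d) ≤ ∏ d ∈ A, (numMessages n (R d) : ℝ) := by
    rw [Real.rpow_sum_of_pos two_pos]
    exact Finset.prod_le_prod (fun _ _ => by positivity) fun d _ => rpow_le_numMessages _ _
  have hr : 1 * Real.exp (n * (M k - ∑ d ∈ A, R d) * Real.log 2 +
        ∑ i, if e i then (if i.1 ∈ B then F * Real.log 2 else 0) else 0) =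
      (2 : ℝ) ^ (n * M k) * (2 ^ F) ^ #{i : 𝒟 × Fin n | i.1 ∈ B ∧ e i} /
        (2 : ℝ) ^ (∑ d ∈ A, n * R d) := by
    rw [hexp, ← pow_mul, ← Real.rpow_natCast, ← Real.rpow_add two_pos, ← Real.rpow_sub two_pos,
      Real.rpow_def_of_pos two_pos, one_mul, ← Finset.mul_sum]
    congr 1
    push_cast
    ring
  rw [hr, div_le_div_iff₀ hL (by positivity), hcard]
  have hc := C.cacheSize_le k
  calc _ ≤ ((∏ d ∈ Aᶜ, (numMessages n (R d) : ℝ)) *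
      (C.cacheSize k * (2 ^ F) ^ #{i : 𝒟 × Fin n | i.1 ∈ B ∧ e i})) *
        ∏ d ∈ A, (numMessages n (R d) : ℝ) := by gcongr
    _ ≤ ((∏ d ∈ Aᶜ, (numMessages n (R d) : ℝ)) *
      ((2 : ℝ) ^ (n * M k) * (2 ^ F) ^ #{i : 𝒟 × Fin n | i.1 ∈ B ∧ e i})) *
        ∏ d ∈ A, (numMessages n (R d) : ℝ) := by gcongr
    _ = _ := by ring

open Classical in
-- Absence of error implies in particular that receiver `k` is correct on `B`.
lemma Code.one_sub_errorProb_le (C : Code F 𝒟 n R M) (Q : ErasureBC F K δ) (k : Fin K)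
    (B : Finset 𝒟) :
    1 - C.errorProb Q ≤ ∑ e : 𝒟 × Fin n → Bool, patternWeight (δ k) e *
      ((#{w | C.Correct k B e w} : ℝ) / Fintype.card (Library n R)) := by
  have : Nonempty (Library n R) := ⟨fun d => ⟨0, numMessages_pos _ _⟩⟩
  have hL : (0 : ℝ) < Fintype.card (Library n R) := by exact_mod_cast Fintype.card_pos
  have hsum : ∀ w : Library n R,
      ∑ y : 𝒟 → Fin n → Fin K → Output F, ∏ d : 𝒟, Q.lawN (C.encode d w) (y d) = 1 := by
    intro w
    rw [← Fintype.prod_sum (fun (d : 𝒟) y => Q.lawN (C.encode d w) y)]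
    simp [sum_lawN]
  have hone : (1 : ℝ) = ∑ w : Library n R, (1 / (Fintype.card (Library n R) : ℝ)) *
      ∑ y : 𝒟 → Fin n → Fin K → Output F, (∏ d : 𝒟, Q.lawN (C.encode d w) (y d)) := by
    simp_rw [hsum, mul_one, Finset.sum_const, Finset.card_univ, nsmul_eq_mul]
    field_simp
  have hright : ∑ e : 𝒟 × Fin n → Bool, patternWeight (δ k) e *
      ((#{w | C.Correct k B e w} : ℝ) / Fintype.card (Library n R)) =
      ∑ w : Library n R, (1 / (Fintype.card (Library n R) : ℝ)) *
        ∑ y : 𝒟 → Fin n → Fin K → Output F, (∏ d : 𝒟, Q.lawN (C.encode d w) (y d)) *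
          (if ∀ c ∈ B, C.decode k c (fun t => y c t k) (C.cache k w) = w (c.1 k)
            then (1 : ℝ) else 0) := by
    have h := fun w : Library n R => sum_prod_lawN_mul_comp Q (fun d : 𝒟 => C.encode d w) k
      (fun z => if ∀ c ∈ B, C.decode k c (z c) (C.cache k w) = w (c.1 k) then (1 : ℝ) else 0)
    simp_rw [h, Finset.mul_sum]
    rw [Finset.sum_comm]
    refine Finset.sum_congr rfl fun e _ => ?_
    rw [Finset.card_filter]
    push_cast
    rw [Finset.sum_div, Finset.mul_sum]
    refine Finset.sum_congr rfl fun w _ => ?_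
    unfold Code.Correct
    split_ifs <;> ring
  rw [hright]
  refine (sub_le_sub_right hone.le _).trans ?_
  unfold Code.errorProb
  rw [← Finset.sum_sub_distrib]
  refine Finset.sum_le_sum fun w _ => ?_
  rw [← mul_sub, ← Finset.sum_sub_distrib]
  refine mul_le_mul_of_nonneg_left (Finset.sum_le_sum fun y _ => ?_) (by positivity)
  have hp : 0 ≤ ∏ d : 𝒟, Q.lawN (C.encode d w) (y d) :=
    Finset.prod_nonneg fun _ _ => lawN_nonneg _ _ _
  generalize (∏ d : 𝒟, Q.lawN (C.encode d w) (y d)) = P at hp ⊢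
  by_cases hE : C.Error w y
  · rw [if_pos hE]
    split_ifs <;> linarith
  · rw [if_neg hE, if_pos]
    · linarith
    · intro c _
      by_contra hne
      exact hE ⟨c, k, hne⟩

lemma commonDemands_bijective (k : Fin K) :
    Function.Bijective fun c : commonDemands K D => c.1 k := by
  refine ⟨?_, fun d => ⟨⟨fun _ => d, by simp [commonDemands]⟩, rfl⟩⟩
  rintro ⟨c, hc⟩ ⟨c', hc'⟩ h
  simp only [commonDemands, Finset.mem_filter, Finset.mem_univ, true_and] at hc hc' h
  refine Subtype.ext (funext fun j => ?_)
  change c j = c' j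
  rw [hc j k, hc' j k, h]

/-- A strong converse: if the inequality fails, the success probability is at most `ρ ^ n` with `ρ <
1`, contradicting error probability at most 1/2. -/
lemma sum_rate_le_of_isAchievable (hδ0 : ∀ k, 0 ≤ δ k) (hδ1 : ∀ k, δ k ≤ 1)
    (Q : ErasureBC F K δ) (h : IsAchievable Q (commonDemands K D) R M) (k : Fin K)
    (A : Finset (Fin D)) : ∑ d ∈ A, (R d - (1 - δ k) * F) ≤ M k := by
  classical
  by_contra! hlt
  obtain ⟨-, hM, hach⟩ := h
  have hlog : 0 < Real.log 2 := Real.log_pos one_lt_two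
  have hA : 0 < #A := by
    rcases A.eq_empty_or_nonempty with rfl | hA
    · simpa using (hM k).trans_lt hlt
    · exact hA.card_pos
  have hA' : (0 : ℝ) < #A := by exact_mod_cast hA
  let B : Finset (commonDemands K D) := {c | c.1 k ∈ A}
  have hAB : ∀ d ∈ A, ∃ c ∈ B, c.1 k = d := by
    intro d hd
    obtain ⟨c, rfl⟩ := (commonDemands_bijective k).surjective d
    exact ⟨c, by simpa [B] using hd, rfl⟩
  have hBA : #B = #A := by
    refine Finset.card_bij (fun c _ => c.1 k) (by simp [B]) ?_ ?_
    · exact fun c _ c' _ h => (commonDemands_bijective k).injective h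
    · intro d hd
      obtain ⟨c, hc, h⟩ := hAB d hd
      exact ⟨c, hc, h⟩
  -- There are `n * #A` relevant slots; dividing by `#A` spreads the exponent evenly over them, so
  -- that the Chernoff bound becomes `(ρ ^ n) ^ #A`.
  set u : ℝ := (M k - ∑ d ∈ A, R d) / #A * Real.log 2 with hu
  have hneg : u + (1 - δ k) * (F * Real.log 2) < 0 := by
    rw [Finset.sum_sub_distrib, Finset.sum_const, nsmul_eq_mul] at hlt
    have : (M k - ∑ d ∈ A, R d) / #A < -((1 - δ k) * F) := by
      rw [div_lt_iff₀ hA']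
      linarith
    rw [hu]
    nlinarith
  obtain ⟨l, hl0, hl1, hl⟩ := exists_exp_mul_lt_one hneg
  set ρ : ℝ := Real.exp (l * u) * ((1 - δ k) * Real.exp (l * (F * Real.log 2)) + δ k) with hρ
  have hρ0 : 0 ≤ ρ := by
    have := hδ0 k
    have : 0 ≤ 1 - δ k := by linarith [hδ1 k]
    positivity
  obtain ⟨n₀, hn₀⟩ := exists_pow_lt_of_lt_one (show (0 : ℝ) < 1 / 2 by norm_num) hl
  obtain ⟨n, hn, C, hC⟩ := hach (1 / 2) (by norm_num) n₀
  have h1 := C.one_sub_errorProb_le Q k B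
  have h2 : ∑ e : commonDemands K D × Fin n → Bool, patternWeight (δ k) e *
      ((#{w | C.Correct k B e w} : ℝ) / Fintype.card (Library n R)) ≤ ρ ^ n := by
    have h3 := sum_patternWeight_min_le (ι := commonDemands K D × Fin n) (hδ0 k) (hδ1 k)
      le_rfl hl0 hl1 (n * (M k - ∑ d ∈ A, R d) * Real.log 2)
      (fun i => if i.1 ∈ B then F * Real.log 2 else 0)
    refine (Finset.sum_le_sum fun e _ => mul_le_mul_of_nonneg_left
      (C.card_correct_div_le k A B hAB e) (patternWeight_nonneg (hδ0 k) (hδ1 k) e)).trans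
      (h3.trans ?_)
    have h4 : ∏ i : commonDemands K D × Fin n, ((1 - δ k) *
        Real.exp (l * if i.1 ∈ B then F * Real.log 2 else 0) + δ k) =
        (((1 - δ k) * Real.exp (l * (F * Real.log 2)) + δ k) ^ n) ^ #A := by
      rw [Fintype.prod_prod_type]
      rw [← hBA, ← Finset.prod_const, ← Finset.prod_subset (Finset.subset_univ B)]
      · exact Finset.prod_congr rfl fun c hc => by simp [hc]
      · intro c _ hc
        simp [hc]
    have h5 : Real.exp (l * (n * (M k - ∑ d ∈ A, R d) * Real.log 2)) =
        (Real.exp (l * u) ^ n) ^ #A := by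
      rw [← pow_mul, ← Real.exp_nat_mul]
      congr 1
      rw [hu]
      push_cast
      field_simp
    rw [h4, h5, one_mul, ← mul_pow, ← mul_pow, ← hρ]
    exact pow_le_of_le_one (by positivity) (pow_le_one₀ hρ0 hl.le) hA.ne'
  have h6 : ρ ^ n ≤ ρ ^ n₀ := pow_le_pow_of_le_one hρ0 hl.le hn
  linarith

end Converse

/-! ### Random codewords and cache indices for a single message. -/

section RandomCoding

open Classical in
-- With `φ` uniform, fix every value except `φ w'`: at most `c` of the choices for `φ w'` are
-- related to `φ w`.
lemma card_pair_mul_card_le {W A : Type*} [Fintype W] [Fintype A] (r : A → A → Prop) {w w' : W}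
    (hw : w ≠ w') {c : ℕ} (hc : ∀ a, #{a' | r a a'} ≤ c) :
    #{φ : W → A | r (φ w) (φ w')} * Fintype.card A ≤ c * Fintype.card (W → A) := by
  have hcard : Fintype.card (W → A) = Fintype.card A * Fintype.card ({j // j ≠ w'} → A) := by
    rw [Fintype.card_congr (Equiv.funSplitAt w' A), Fintype.card_prod]
  have h : #{φ : W → A | r (φ w) (φ w')} ≤ Fintype.card ({j // j ≠ w'} → A) * c := by
    rw [Finset.card_filter, ← Equiv.sum_comp (Equiv.funSplitAt w' A).symm,
      Fintype.sum_prod_type_right]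
    calc _ = ∑ ψ : {j // j ≠ w'} → A, #{a' | r (ψ ⟨w, hw⟩) a'} := by
          refine Finset.sum_congr rfl fun ψ _ => ?_
          rw [Finset.card_filter]
          refine Finset.sum_congr rfl fun a _ => ?_
          simp [Equiv.funSplitAt, Equiv.piSplitAt, hw]
      _ ≤ ∑ ψ : {j // j ≠ w'} → A, c := Finset.sum_le_sum fun ψ _ => hc _
      _ = _ := by simp
  rw [hcard]
  nlinarith

variable {F K n : ℕ} {H : Fin K → ℕ} {W : Type*}

/-- A codeword together with one cache index for every receiver. -/
abbrev Label (F n : ℕ) (H : Fin K → ℕ) : Type := (Fin n → Packet F) × (∀ k, Fin (H k))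

/-- Receiver `k` cannot tell the labels apart when `e` is its erasure pattern. -/
def Confusable (k : Fin K) (e : Fin n → Bool) (a a' : Label F n H) : Prop :=
  a'.2 k = a.2 k ∧ ∀ i, e i = true → a'.1 i = a.1 i

/-- Some other message has a label that receiver `k` cannot tell from that of `w`. -/
def Ambiguous (φ : W → Label F n H) (k : Fin K) (e : Fin n → Bool) (w : W) : Prop :=
  ∃ w', w' ≠ w ∧ Confusable k e (φ w) (φ w')

open Classical in
lemma card_confusable (k : Fin K) (e : Fin n → Bool) (a : Label F n H) :
    #{a' | Confusable k e a a'} * (H k * (2 ^ F) ^ #{i | e i}) =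
      Fintype.card (Label F n H) := by
  have h1 : ({a' | Confusable k e a a'} : Finset (Label F n H)) =
      (Fintype.piFinset fun i => if e i then {a.1 i} else univ) ×ˢ
        (Fintype.piFinset fun j => if j = k then {a.2 j} else univ) := by
    ext ⟨x, z⟩
    rw [Finset.mem_filter, Finset.mem_product, Fintype.mem_piFinset, Fintype.mem_piFinset]
    refine ⟨fun h => ⟨fun i => ?_, fun j => ?_⟩, fun h => ⟨Finset.mem_univ _, ?_, fun i hi => ?_⟩⟩
    · by_cases hi : e i = true
      · simpa [hi] using h.2.2 i hi
      · simp [hi]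
    · by_cases hj : j = k
      · subst hj
        simpa using h.2.1
      · simp [hj]
    · simpa using h.2 k
    · simpa [hi] using h.1 i
  have h2 : (2 ^ F) ^ #{i | e i} = ∏ i, if e i then 2 ^ F else 1 := by
    rw [← Finset.prod_filter, Finset.prod_const]
  have h3 : H k = ∏ j, if j = k then H j else 1 := by simp
  have h4 : (∏ i, #(if e i then {a.1 i} else univ)) * (2 ^ F) ^ #{i | e i} =
      Fintype.card (Fin n → Packet F) := by
    rw [h2, ← Finset.prod_mul_distrib, Fintype.card_pi]
    refine Finset.prod_congr rfl fun i _ => ?_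
    by_cases hi : e i = true <;> simp [hi]
  have h5 : (∏ j, #(if j = k then {a.2 j} else univ)) * H k =
      Fintype.card (∀ k, Fin (H k)) := by
    conv_lhs => rw [h3]
    rw [← Finset.prod_mul_distrib, Fintype.card_pi]
    refine Finset.prod_congr rfl fun j _ => ?_
    by_cases hj : j = k <;> simp [hj]
  rw [h1, Finset.card_product, Fintype.card_piFinset, Fintype.card_piFinset, Fintype.card_prod,
    ← h4, ← h5]
  ring

open Classical in
-- Union bound over the other messages. The `- 1` matters: a one-element message set is never
-- ambiguous.
lemma sum_ambiguous_le [Fintype W] [Nonempty W] (hH : ∀ k, 0 < H k) (k : Fin K) (e : Fin n → Bool) (w : W) :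
    ∑ φ : W → Label F n H, (if Ambiguous φ k e w then (1 : ℝ) else 0) ≤
      Fintype.card (W → Label F n H) *
        min 1 ((Fintype.card W - 1 : ℝ) / (H k * (2 ^ F) ^ #{i | e i})) := by
  have hk : (0 : ℝ) < H k := by exact_mod_cast hH k
  have : Nonempty (Label F n H) := ⟨fun _ _ => false, fun k => ⟨0, hH k⟩⟩
  have hA : (0 : ℝ) < Fintype.card (Label F n H) := by exact_mod_cast Fintype.card_pos
  rw [mul_min_of_nonneg _ _ (Nat.cast_nonneg _), mul_one]
  refine le_min ?_ ?_
  · calc _ ≤ ∑ φ : W → Label F n H, (1 : ℝ) :=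
          Finset.sum_le_sum fun _ _ => by split_ifs <;> norm_num
      _ = _ := by simp
  have hpair : ∀ w' ∈ univ.erase w,
      ∑ φ : W → Label F n H, (if Confusable k e (φ w) (φ w') then (1 : ℝ) else 0) ≤
        Fintype.card (W → Label F n H) / (H k * (2 ^ F) ^ #{i | e i}) := by
    intro w' hw'
    have h0 : ∀ a : Label F n H, #{a' | Confusable k e a a'} ≤
        #{a' | Confusable k e (Classical.arbitrary (Label F n H)) a'} := by
      intro a
      refine Nat.le_of_mul_le_mul_right (c := H k * (2 ^ F) ^ #{i | e i}) ?_
        (Nat.mul_pos (hH k) (by positivity))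
      rw [card_confusable, card_confusable]
    have h1 := card_pair_mul_card_le (W := W) (Confusable k e) (Finset.ne_of_mem_erase hw').symm h0
    have h2 := card_confusable k e (Classical.arbitrary (Label F n H))
    generalize #{a' | Confusable k e (Classical.arbitrary (Label F n H)) a'} = c at h1 h2
    rw [Finset.card_filter] at h1
    rw [le_div_iff₀ (by positivity)]
    have h1' : (∑ φ : W → Label F n H, (if Confusable k e (φ w) (φ w') then (1 : ℝ) else 0)) *
        Fintype.card (Label F n H) ≤ c * Fintype.card (W → Label F n H) := by
      exact_mod_cast h1
    have h2' : (c : ℝ) * (H k * (2 ^ F) ^ #{i | e i}) = Fintype.card (Label F n H) := by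
      exact_mod_cast h2
    refine le_of_mul_le_mul_right ?_ hA
    calc _ = (∑ φ : W → Label F n H, (if Confusable k e (φ w) (φ w') then (1 : ℝ) else 0)) *
          Fintype.card (Label F n H) * (H k * (2 ^ F) ^ #{i | e i}) := by ring
      _ ≤ c * Fintype.card (W → Label F n H) * (H k * (2 ^ F) ^ #{i | e i}) := by gcongr
      _ = _ := by rw [← h2']; ring
  calc _ ≤ ∑ φ : W → Label F n H, ∑ w' ∈ univ.erase w,
        (if Confusable k e (φ w) (φ w') then (1 : ℝ) else 0) := by
        refine Finset.sum_le_sum fun φ _ => ?_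
        by_cases h : Ambiguous φ k e w
        · obtain ⟨w', hne, hc⟩ := id h
          rw [if_pos h]
          refine le_trans ?_ (Finset.single_le_sum (fun _ _ => by split_ifs <;> norm_num)
            (Finset.mem_erase.2 ⟨hne, Finset.mem_univ w'⟩))
          rw [if_pos hc]
        · rw [if_neg h]
          exact Finset.sum_nonneg fun _ _ => by split_ifs <;> norm_num
    _ = ∑ w' ∈ univ.erase w, ∑ φ : W → Label F n H,
        (if Confusable k e (φ w) (φ w') then (1 : ℝ) else 0) := Finset.sum_comm
    _ ≤ ∑ w' ∈ univ.erase w,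
        (Fintype.card (W → Label F n H) / (H k * (2 ^ F) ^ #{i | e i}) : ℝ) :=
        Finset.sum_le_sum hpair
    _ = _ := by
        rw [Finset.sum_const, Finset.card_erase_of_mem (Finset.mem_univ w), Finset.card_univ,
          nsmul_eq_mul, Nat.cast_sub Fintype.card_pos]
        push_cast
        ring

open Classical in
-- Some labelling is no worse than average. The sum over `k` is averaged as a whole, so one
-- labelling serves all receivers.
lemma exists_label [Fintype W] [Nonempty W] (hH : ∀ k, 0 < H k) {δ : Fin K → ℝ} (h0 : ∀ k, 0 ≤ δ k)
    (h1 : ∀ k, δ k ≤ 1) :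
    ∃ φ : W → Label F n H,
      ∑ k, ∑ w, (1 / (Fintype.card W : ℝ)) * ∑ e : Fin n → Bool, patternWeight (δ k) e *
          (if Ambiguous φ k e w then 1 else 0) ≤
        ∑ k, ∑ e : Fin n → Bool, patternWeight (δ k) e *
          min 1 ((Fintype.card W - 1 : ℝ) / (H k * (2 ^ F) ^ #{i | e i})) := by
  have : Nonempty (Label F n H) := ⟨fun _ _ => false, fun k => ⟨0, hH k⟩⟩
  have hW : (0 : ℝ) < Fintype.card W := by exact_mod_cast Fintype.card_pos
  suffices h : ∑ φ : W → Label F n H, ∑ k, ∑ w, (1 / (Fintype.card W : ℝ)) *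
      ∑ e : Fin n → Bool, patternWeight (δ k) e * (if Ambiguous φ k e w then 1 else 0) ≤
      ∑ φ : W → Label F n H, ∑ k, ∑ e : Fin n → Bool, patternWeight (δ k) e *
        min 1 ((Fintype.card W - 1 : ℝ) / (H k * (2 ^ F) ^ #{i | e i})) by
    obtain ⟨φ, -, hφ⟩ := Finset.exists_le_of_sum_le Finset.univ_nonempty h
    exact ⟨φ, hφ⟩
  rw [Finset.sum_const, Finset.card_univ, nsmul_eq_mul, Finset.sum_comm, Finset.mul_sum]
  refine Finset.sum_le_sum fun k _ => ?_
  rw [Finset.sum_comm]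
  have key : ∀ w : W, ∑ φ : W → Label F n H, (1 / (Fintype.card W : ℝ)) *
      ∑ e : Fin n → Bool, patternWeight (δ k) e * (if Ambiguous φ k e w then 1 else 0) ≤
      (1 / (Fintype.card W : ℝ)) * (Fintype.card (W → Label F n H) *
        ∑ e : Fin n → Bool, patternWeight (δ k) e *
        min 1 ((Fintype.card W - 1 : ℝ) / (H k * (2 ^ F) ^ #{i | e i}))) := by
    intro w
    rw [← Finset.mul_sum, Finset.sum_comm]
    refine mul_le_mul_of_nonneg_left ?_ (by positivity)
    rw [Finset.mul_sum]
    refine Finset.sum_le_sum fun e _ => ?_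
    rw [← Finset.mul_sum, mul_left_comm]
    exact mul_le_mul_of_nonneg_left (sum_ambiguous_le hH k e w)
      (patternWeight_nonneg (h0 k) (h1 k) e)
  refine (Finset.sum_le_sum fun w _ => key w).trans_eq ?_
  rw [Finset.sum_const, Finset.card_univ, nsmul_eq_mul]
  field_simp

/-- The decoder at receiver `k`: any message consistent with the outputs and the cache index. -/
def labelDecode [Nonempty W] (φ : W → Label F n H) (k : Fin K) (z : Fin n → Output F)
    (s : Fin (H k)) : W :=
  Classical.epsilon fun w => (φ w).2 k = s ∧ ∀ i p, z i = some p → (φ w).1 i = p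

/-- The true message is consistent with what is received, so the choice returns a consistent
message; a different one would make `w` ambiguous. -/
lemma labelDecode_eq [Nonempty W] {φ : W → Label F n H} {k : Fin K} {e : Fin n → Bool} {w : W}
    (h : ¬ Ambiguous φ k e w) :
    labelDecode φ k (observe (φ w).1 e) ((φ w).2 k) = w := by
  have hspec : (φ (labelDecode φ k (observe (φ w).1 e) ((φ w).2 k))).2 k = (φ w).2 k ∧
      ∀ i p, observe (φ w).1 e i = some p →
        (φ (labelDecode φ k (observe (φ w).1 e) ((φ w).2 k))).1 i = p := by
    refine Classical.epsilon_spec (p := fun w' => (φ w').2 k = (φ w).2 k ∧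
      ∀ i p, observe (φ w).1 e i = some p → (φ w').1 i = p) ⟨w, rfl, fun i p hp => ?_⟩
    unfold observe at hp
    split_ifs at hp
    exact Option.some.inj hp
  by_contra hne
  exact h ⟨_, hne, hspec.1, fun i hi => hspec.2 i _ (by simp [observe, hi])⟩

end RandomCoding

/-! ### Combining the single-message codes. -/

section Achievability

variable {F K D n : ℕ} {R : Fin D → ℝ} {M : Fin K → ℝ} {δ : Fin K → ℝ}

instance (n : ℕ) (r : ℝ) : Nonempty (Fin (numMessages n r)) := ⟨⟨0, numMessages_pos n r⟩⟩

/-- The code that caches one index for every message and sends the codeword of the demanded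
message. -/
def splitCode {H : Fin D → Fin K → ℕ}
    (φ : ∀ d, Fin (numMessages n (R d)) → Label F n (H d))
    (hH : ∀ k, (Fintype.card (∀ d, Fin (H d k)) : ℝ) ≤ (2 : ℝ) ^ ((n : ℝ) * M k)) :
    Code F (commonDemands K D) n R M where
  cacheSize k := Fintype.card (∀ d, Fin (H d k))
  cacheSize_le := hH
  cache k w := Fintype.equivFin _ fun d => (φ d (w d)).2 k
  encode c w := open Classical in
    -- All receivers request the same message, so any of them identifies it; the default covers `K =
    -- 0`.
    if h : Nonempty (Fin K) then (φ (c.1 h.some) (w (c.1 h.some))).1 else fun _ _ => false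
  decode k c z s := labelDecode (φ (c.1 k)) k z ((Fintype.equivFin _).symm s (c.1 k))

lemma splitCode_encode {H : Fin D → Fin K → ℕ}
    (φ : ∀ d, Fin (numMessages n (R d)) → Label F n (H d))
    (hH : ∀ k, (Fintype.card (∀ d, Fin (H d k)) : ℝ) ≤ (2 : ℝ) ^ ((n : ℝ) * M k))
    (c : commonDemands K D) (w : Library n R) (k : Fin K) :
    (splitCode φ hH).encode c w = (φ (c.1 k) (w (c.1 k))).1 := by
  have h : Nonempty (Fin K) := ⟨k⟩
  have hc : c.1 h.some = c.1 k := by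
    have := c.2
    simp only [commonDemands, Finset.mem_filter, Finset.mem_univ, true_and] at this
    exact this _ _
  simp only [splitCode, h, dif_pos]
  rw [hc]

open Classical in
-- Union bound over demands and receivers; each term involves one delivery phase and one message,
-- and everything else integrates out.
lemma splitCode_errorProb_le {H : Fin D → Fin K → ℕ}
    (φ : ∀ d, Fin (numMessages n (R d)) → Label F n (H d))
    (hH : ∀ k, (Fintype.card (∀ d, Fin (H d k)) : ℝ) ≤ (2 : ℝ) ^ ((n : ℝ) * M k))
    (hδ0 : ∀ k, 0 ≤ δ k) (hδ1 : ∀ k, δ k ≤ 1) (Q : ErasureBC F K δ) :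
    (splitCode φ hH).errorProb Q ≤ ∑ d, ∑ k, ∑ v,
      (1 / (Fintype.card (Fin (numMessages n (R d))) : ℝ)) *
        ∑ e : Fin n → Bool, patternWeight (δ k) e * (if Ambiguous (φ d) k e v then 1 else 0) := by
  set C := splitCode φ hH with hC
  have hL : (1 / (Fintype.card (Library n R) : ℝ)) =
      ∏ d, (1 / (Fintype.card (Fin (numMessages n (R d))) : ℝ)) := by
    rw [Fintype.card_pi]
    push_cast
    simp
  have hsingle : ∀ (c : commonDemands K D) (k : Fin K) (w : Library n R),
      ∑ y : commonDemands K D → Fin n → Fin K → Output F,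
        (∏ d, Q.lawN (C.encode d w) (y d)) *
          (if C.decode k c (fun t => y c t k) (C.cache k w) ≠ w (c.1 k) then (1 : ℝ) else 0) ≤
      ∑ e : Fin n → Bool, patternWeight (δ k) e *
        (if Ambiguous (φ (c.1 k)) k e (w (c.1 k)) then 1 else 0) := by
    intro c k w
    rw [sum_prod_mul_apply (fun d y => Q.lawN (C.encode d w) y) (fun d => sum_lawN Q _) c
      (fun y => if C.decode k c (fun t => y t k) (C.cache k w) ≠ w (c.1 k) then (1 : ℝ) else 0)]
    unfold ErasureBC.lawN
    rw [sum_law_mul_comp Q (C.encode c w) k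
      (fun z => if C.decode k c z (C.cache k w) ≠ w (c.1 k) then (1 : ℝ) else 0)]
    refine Finset.sum_le_sum fun e _ => mul_le_mul_of_nonneg_left ?_
      (patternWeight_nonneg (hδ0 k) (hδ1 k) e)
    by_cases ha : Ambiguous (φ (c.1 k)) k e (w (c.1 k))
    · rw [if_pos ha]
      split_ifs <;> norm_num
    · rw [if_neg ha, if_neg]
      rw [not_not, hC, splitCode_encode φ hH c w k]
      simp only [splitCode, Equiv.symm_apply_apply]
      exact labelDecode_eq ha
  have hunion : ∀ (w : Library n R) (y : commonDemands K D → Fin n → Fin K → Output F),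
      (if C.Error w y then (1 : ℝ) else 0) ≤ ∑ c : commonDemands K D, ∑ k : Fin K,
        (if C.decode k c (fun t => y c t k) (C.cache k w) ≠ w (c.1 k) then (1 : ℝ) else 0) := by
    intro w y
    have hnn : ∀ (c : commonDemands K D) (k : Fin K), (0 : ℝ) ≤
        (if C.decode k c (fun t => y c t k) (C.cache k w) ≠ w (c.1 k) then (1 : ℝ) else 0) :=
      fun c k => by split_ifs <;> norm_num
    by_cases hE : C.Error w y
    · obtain ⟨c, k, hck⟩ := id hE
      rw [if_pos hE]
      refine le_trans ?_ (Finset.single_le_sum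
        (fun c _ => Finset.sum_nonneg fun k _ => hnn c k) (Finset.mem_univ c))
      refine le_trans ?_ (Finset.single_le_sum (fun k _ => hnn c k) (Finset.mem_univ k))
      rw [if_pos hck]
    · rw [if_neg hE]
      exact Finset.sum_nonneg fun c _ => Finset.sum_nonneg fun k _ => hnn c k
  unfold Code.errorProb
  calc _ ≤ ∑ w : Library n R, (1 / (Fintype.card (Library n R) : ℝ)) *
        ∑ c : commonDemands K D, ∑ k : Fin K, ∑ e : Fin n → Bool, patternWeight (δ k) e *
          (if Ambiguous (φ (c.1 k)) k e (w (c.1 k)) then 1 else 0) := by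
        refine Finset.sum_le_sum fun w _ => mul_le_mul_of_nonneg_left ?_ (by positivity)
        refine (Finset.sum_le_sum fun y _ => mul_le_mul_of_nonneg_left (hunion w y)
          (Finset.prod_nonneg fun _ _ => lawN_nonneg Q _ _)).trans ?_
        refine Eq.trans_le ?_ (Finset.sum_le_sum fun c _ =>
          Finset.sum_le_sum fun k _ => hsingle c k w)
        simp_rw [Finset.mul_sum]
        rw [Finset.sum_comm]
        exact Finset.sum_congr rfl fun c _ => Finset.sum_comm
    _ = ∑ k : Fin K, ∑ c : commonDemands K D, ∑ v,
          (1 / (Fintype.card (Fin (numMessages n (R (c.1 k)))) : ℝ)) *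
          ∑ e : Fin n → Bool, patternWeight (δ k) e *
            (if Ambiguous (φ (c.1 k)) k e v then 1 else 0) := by
        have hone : ∀ d, ∑ _v : Fin (numMessages n (R d)),
            (1 / (Fintype.card (Fin (numMessages n (R d))) : ℝ)) = 1 := by
          intro d
          have := Fintype.card_pos (α := Fin (numMessages n (R d)))
          rw [Finset.sum_const, Finset.card_univ, nsmul_eq_mul]
          field_simp
        have hmarg := fun (c : commonDemands K D) (k : Fin K) => sum_prod_mul_apply
          (fun d (_ : Fin (numMessages n (R d))) =>
            (1 / (Fintype.card (Fin (numMessages n (R d))) : ℝ))) hone (c.1 k)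
          (fun v => ∑ e : Fin n → Bool, patternWeight (δ k) e *
            (if Ambiguous (φ (c.1 k)) k e v then 1 else 0))
        refine Eq.trans ?_ (Finset.sum_congr rfl fun k _ =>
          Finset.sum_congr rfl fun c _ => hmarg c k)
        rw [Finset.sum_comm, hL]
        simp_rw [Finset.mul_sum (univ : Finset (commonDemands K D)),
          Finset.mul_sum (univ : Finset (Fin K))]
        rw [Finset.sum_comm]
        exact Finset.sum_congr rfl fun c _ => Finset.sum_comm
    _ = ∑ k : Fin K, ∑ d, ∑ v, (1 / (Fintype.card (Fin (numMessages n (R d))) : ℝ)) *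
          ∑ e : Fin n → Bool, patternWeight (δ k) e *
            (if Ambiguous (φ d) k e v then 1 else 0) :=
        Finset.sum_congr rfl fun k _ => (commonDemands_bijective k).sum_comp
          (fun d => ∑ v, (1 / (Fintype.card (Fin (numMessages n (R d))) : ℝ)) *
            ∑ e : Fin n → Bool, patternWeight (δ k) e *
              (if Ambiguous (φ d) k e v then 1 else 0))
    _ = _ := Finset.sum_comm

/-- Rounding the number of cache indices down costs at most the factor 2 that appears as `C` in the
tail bound. -/
lemma half_rpow_le_floor {x : ℝ} (hx : 1 ≤ x) : x / 2 ≤ ⌊x⌋₊ := by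
  have h1 := Nat.lt_floor_add_one x
  have h2 : (1 : ℝ) ≤ ⌊x⌋₊ := by exact_mod_cast Nat.one_le_floor_iff _ |>.2 hx
  linarith

lemma tendsto_sum_min_collision {F : ℕ} {δ r s : ℝ} (h0 : 0 ≤ δ) (h1 : δ ≤ 1) (hs : 0 ≤ s)
    (hrs : r = 0 ∨ r < (1 - δ) * F + s) :
    Filter.Tendsto (fun n : ℕ => ∑ e : Fin n → Bool, patternWeight δ e *
      min 1 ((Fintype.card (Fin (numMessages n r)) - 1 : ℝ) /
        (⌊(2 : ℝ) ^ ((n : ℝ) * s)⌋₊ * (2 ^ F) ^ #{i | e i}))) Filter.atTop (nhds 0) := by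
  rcases hrs with rfl | hrs
  -- At rate zero there is one message, so the numerator vanishes; no strict rate inequality is
  -- needed.
  · simp [numMessages]
  have hlog : 0 < Real.log 2 := Real.log_pos one_lt_two
  have hneg : (r - s) * Real.log 2 + (1 - δ) * (-(F * Real.log 2)) < 0 := by nlinarith
  obtain ⟨l, hl0, hl1, hl⟩ := exists_exp_mul_lt_one hneg
  set ρ : ℝ := Real.exp (l * ((r - s) * Real.log 2)) *
    ((1 - δ) * Real.exp (l * (-(F * Real.log 2))) + δ) with hρ
  have hρ0 : 0 ≤ ρ := by
    have : 0 ≤ 1 - δ := by linarith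
    positivity
  have hlim : Filter.Tendsto (fun n : ℕ => 2 * ρ ^ n) Filter.atTop (nhds 0) := by
    simpa using (tendsto_pow_atTop_nhds_zero_of_lt_one hρ0 hl).const_mul 2
  have hN : ∀ n : ℕ, (0 : ℝ) ≤ Fintype.card (Fin (numMessages n r)) - 1 := by
    intro n
    have : 1 ≤ numMessages n r := numMessages_pos n r
    rw [Fintype.card_fin, sub_nonneg]
    exact_mod_cast this
  refine squeeze_zero (fun n => ?_) (fun n => ?_) hlim
  · refine Finset.sum_nonneg fun e _ => mul_nonneg (patternWeight_nonneg h0 h1 e) ?_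
    exact le_min zero_le_one (div_nonneg (hN n) (by positivity))
  have hbound : ∀ e : Fin n → Bool,
      min 1 ((Fintype.card (Fin (numMessages n r)) - 1 : ℝ) /
        (⌊(2 : ℝ) ^ ((n : ℝ) * s)⌋₊ * (2 ^ F) ^ #{i | e i})) ≤
      min 1 (2 * Real.exp (n * ((r - s) * Real.log 2) +
        ∑ i, if e i then -(F * Real.log 2) else 0)) := by
    intro e
    refine min_le_min le_rfl ?_
    have e1 : (Fintype.card (Fin (numMessages n r)) - 1 : ℝ) ≤ (2 : ℝ) ^ ((n : ℝ) * r) := by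
      have := Nat.ceil_lt_add_one (show 0 ≤ (2 : ℝ) ^ ((n : ℝ) * r) by positivity)
      rw [Fintype.card_fin, numMessages]
      linarith
    have e2 := half_rpow_le_floor
      (Real.one_le_rpow one_le_two (show 0 ≤ (n : ℝ) * s by positivity))
    have e3 : 2 * Real.exp (n * ((r - s) * Real.log 2) +
        ∑ i, if e i then -(F * Real.log 2) else 0) =
        (2 : ℝ) ^ ((n : ℝ) * r) / ((2 : ℝ) ^ ((n : ℝ) * s) / 2 * (2 ^ F) ^ #{i | e i}) := by
      have e4 : (∑ i, if e i then -(F * Real.log 2) else 0) =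
          -(Real.log 2 * (F * #{i | e i})) := by
        rw [← Finset.sum_filter, Finset.sum_const, nsmul_eq_mul]
        ring
      have e5 : Real.exp (n * ((r - s) * Real.log 2) + -(Real.log 2 * (F * #{i | e i}))) =
          (2 : ℝ) ^ ((n : ℝ) * r) / ((2 : ℝ) ^ ((n : ℝ) * s) * (2 ^ F) ^ #{i | e i}) := by
        rw [← pow_mul, ← Real.rpow_natCast, ← Real.rpow_add two_pos, ← Real.rpow_sub two_pos,
          Real.rpow_def_of_pos two_pos]
        congr 1
        push_cast
        ring
      rw [e4, e5]
      field_simp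
    rw [e3]
    gcongr
  refine (Finset.sum_le_sum fun e _ => mul_le_mul_of_nonneg_left (hbound e)
    (patternWeight_nonneg h0 h1 e)).trans
    ((sum_patternWeight_min_le h0 h1 one_le_two hl0 hl1 _ _).trans_eq ?_)
  rw [Finset.prod_const, Finset.card_univ, Fintype.card_fin, hρ, mul_pow, ← Real.exp_nat_mul,
    mul_left_comm, mul_assoc]

lemma isAchievable_of_lt (hδ0 : ∀ k, 0 ≤ δ k) (hδ1 : ∀ k, δ k ≤ 1) (Q : ErasureBC F K δ)
    (hR : ∀ d, 0 ≤ R d) (hM : ∀ k, 0 ≤ M k) {S : Fin K → Fin D → ℝ} (hS : IsCacheSplit M S)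
    (h : ∀ d, 0 < R d → ∀ k, R d < (1 - δ k) * F + S k d) :
    IsAchievable Q (commonDemands K D) R M := by
  refine ⟨hR, hM, fun ε hε n₀ => ?_⟩
  have hlim : Filter.Tendsto (fun n : ℕ => ∑ d, ∑ k, ∑ e : Fin n → Bool, patternWeight (δ k) e *
      min 1 ((Fintype.card (Fin (numMessages n (R d))) - 1 : ℝ) /
        (⌊(2 : ℝ) ^ ((n : ℝ) * S k d)⌋₊ * (2 ^ F) ^ #{i | e i}))) Filter.atTop (nhds 0) := by
    have := tendsto_finsetSum (univ : Finset (Fin D)) fun d _ =>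
      tendsto_finsetSum (univ : Finset (Fin K)) fun k _ =>
        tendsto_sum_min_collision (F := F) (r := R d) (hδ0 k) (hδ1 k) (hS.1 k d)
          ((hR d).eq_or_lt.imp Eq.symm fun hpos => h d hpos k)
    simpa using this
  obtain ⟨n, hn, hnε⟩ := ((Filter.eventually_ge_atTop n₀).and
    ((tendsto_order.1 hlim).2 ε hε)).exists
  have hH : ∀ d k, 0 < ⌊(2 : ℝ) ^ ((n : ℝ) * S k d)⌋₊ := fun d k =>
    Nat.floor_pos.2 (Real.one_le_rpow one_le_two (mul_nonneg n.cast_nonneg (hS.1 k d)))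
  choose φ hφ using fun d => exists_label (F := F) (n := n) (W := Fin (numMessages n (R d)))
    (hH d) hδ0 hδ1
  have hcache : ∀ k, (Fintype.card (∀ d, Fin ⌊(2 : ℝ) ^ ((n : ℝ) * S k d)⌋₊) : ℝ) ≤
      (2 : ℝ) ^ ((n : ℝ) * M k) := by
    intro k
    rw [Fintype.card_pi]
    push_cast
    simp only [Fintype.card_fin]
    calc _ ≤ ∏ d, (2 : ℝ) ^ ((n : ℝ) * S k d) :=
          Finset.prod_le_prod (fun _ _ => by positivity) fun d _ => Nat.floor_le (by positivity)
      _ = (2 : ℝ) ^ ((n : ℝ) * ∑ d, S k d) := by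
          rw [← Real.rpow_sum_of_pos two_pos, Finset.mul_sum]
      _ ≤ _ := by
          have := hS.2 k
          gcongr
          norm_num
  refine ⟨n, hn, splitCode φ hcache, (splitCode_errorProb_le φ hcache hδ0 hδ1 Q).trans ?_⟩
  exact (Finset.sum_le_sum fun d _ => hφ d).trans hnε.le

end Achievability

/-! ### From achievable tuples to their closure. -/

section Region

variable {F K D : ℕ} {δ : Fin K → ℝ}

/-- The cheapest split gives each message exactly the positive part of its rate deficit at receiver
`k`. -/
lemma exists_split_iff {R : Fin D → ℝ} {M : Fin K → ℝ} :
    (∃ S : Fin K → Fin D → ℝ, IsCacheSplit M S ∧ ∀ d k, R d ≤ (1 - δ k) * F + S k d) ↔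
      ∀ k, ∑ d, max 0 (R d - (1 - δ k) * F) ≤ M k := by
  constructor
  · rintro ⟨S, hS, h⟩ k
    refine le_trans (Finset.sum_le_sum fun d _ => ?_) (hS.2 k)
    exact max_le (hS.1 k d) (by linarith [h d k])
  · intro h
    refine ⟨fun k d => max 0 (R d - (1 - δ k) * F), ⟨fun _ _ => le_max_left _ _, h⟩, fun d k => ?_⟩
    linarith [le_max_right 0 (R d - (1 - δ k) * F)]

lemma isClosed_setOf_sum_max_le (F : ℕ) (δ : Fin K → ℝ) :
    IsClosed {p : (Fin D → ℝ) × (Fin K → ℝ) |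
      ∀ k, ∑ d, max 0 (p.1 d - (1 - δ k) * F) ≤ p.2 k} := by
  simp only [Set.ofPred_forall]
  exact isClosed_iInter fun k => isClosed_le (by fun_prop) (by fun_prop)

/-- The set `A` of messages with nonnegative deficit turns the subset bound into a sum of positive
parts. -/
lemma sum_max_le_of_isAchievable (hδ0 : ∀ k, 0 ≤ δ k) (hδ1 : ∀ k, δ k ≤ 1)
    (Q : ErasureBC F K δ) {R : Fin D → ℝ} {M : Fin K → ℝ}
    (h : IsAchievable Q (commonDemands K D) R M) (k : Fin K) :
    ∑ d, max 0 (R d - (1 - δ k) * F) ≤ M k := by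
  classical
  refine le_trans (le_of_eq ?_)
    (sum_rate_le_of_isAchievable hδ0 hδ1 Q h k {d | 0 ≤ R d - (1 - δ k) * F})
  rw [Finset.sum_filter]
  refine Finset.sum_congr rfl fun d _ => ?_
  split_ifs with hd
  · exact max_eq_right hd
  · exact max_eq_left (not_le.1 hd).le

/-- Lowering all rates by `η > 0`, truncated at 0, makes every inequality with a positive rate
strict; then `η` tends to 0. -/
lemma mem_capacityMemoryRegion_of_le (hδ0 : ∀ k, 0 ≤ δ k) (hδ1 : ∀ k, δ k ≤ 1)
    (Q : ErasureBC F K δ) {R : Fin D → ℝ} {M : Fin K → ℝ} (hR : ∀ d, 0 ≤ R d)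
    (hM : ∀ k, 0 ≤ M k) {S : Fin K → Fin D → ℝ} (hS : IsCacheSplit M S)
    (h : ∀ d k, R d ≤ (1 - δ k) * F + S k d) :
    (R, M) ∈ capacityMemoryRegion Q (commonDemands K D) := by
  have hlim : Filter.Tendsto (fun η : ℝ => ((fun d => max 0 (R d - η)), M))
      (nhdsWithin 0 (Set.Ioi 0)) (nhds (R, M)) := by
    have hc : Continuous fun η : ℝ => ((fun d => max 0 (R d - η)), M) := by fun_prop
    have := hc.tendsto 0
    simp only [sub_zero, max_eq_right (hR _)] at this
    exact this.mono_left nhdsWithin_le_nhds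
  refine mem_closure_of_tendsto hlim ?_
  filter_upwards [self_mem_nhdsWithin] with η hη
  refine isAchievable_of_lt hδ0 hδ1 Q (fun d => le_max_left _ _) hM hS fun d hd k => ?_
  have hη' : 0 < η := hη
  have : 0 < R d - η := by simpa using hd
  rw [max_eq_right this.le]
  linarith [h d k]

end Region

end ErasureCaching

end

theorem theorem1 {F K D : ℕ} (hF : 0 < F) (δ : Fin K → ℝ)
    (hδ0 : ∀ k, 0 ≤ δ k) (hδ1 : ∀ k, δ k ≤ 1) (hδ : Antitone δ)
    (Q : ErasureCaching.ErasureBC F K δ)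
    (R : Fin D → ℝ) (M : Fin K → ℝ) (hR : ∀ d, 0 ≤ R d) (hM : ∀ k, 0 ≤ M k) :
    ((R, M) ∈ ErasureCaching.capacityMemoryRegion Q (ErasureCaching.commonDemands K D) ↔
      ∃ S : Fin K → Fin D → ℝ, ErasureCaching.IsCacheSplit M S ∧
        ∀ d k, R d ≤ (1 - δ k) * F + S k d) ∧
    (ErasureCaching.IsAchievable Q (ErasureCaching.commonDemands K D) R M →
      ∃ S : Fin K → Fin D → ℝ, ErasureCaching.IsCacheSplit M S ∧
        ∀ d k, R d ≤ (1 - δ k) * F + S k d) ∧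
    ((∃ S : Fin K → Fin D → ℝ, ErasureCaching.IsCacheSplit M S ∧
        ∀ d, 0 < R d → ∀ k, R d < (1 - δ k) * F + S k d) →
      ErasureCaching.IsAchievable Q (ErasureCaching.commonDemands K D) R M) := by
  refine ⟨⟨fun h => ?_, fun ⟨S, hS, h⟩ => ?_⟩, fun h => ?_, fun ⟨S, hS, h⟩ => ?_⟩
  · refine ErasureCaching.exists_split_iff.2 ?_
    have hmem := closure_minimal
      (fun p hp => ErasureCaching.sum_max_le_of_isAchievable hδ0 hδ1 Q hp)
      (ErasureCaching.isClosed_setOf_sum_max_le F δ) h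
    exact hmem
  · exact ErasureCaching.mem_capacityMemoryRegion_of_le hδ0 hδ1 Q hR hM hS h
  · exact ErasureCaching.exists_split_iff.2
      (ErasureCaching.sum_max_le_of_isAchievable hδ0 hδ1 Q h)
  · exact ErasureCaching.isAchievable_of_lt hδ0 hδ1 Q hR hM hS h
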